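/- Let $\sigma_x,\sigma_y$ be the Pauli matrices, let $|0,0\rangle,|0,1\rangle\in\mathbb{C}^2$ be orthogonal unit eigenvectors of $\sigma_x$, and let $|1,0\rangle,|1,1\rangle\in\mathbb{C}^2$ be orthogonal unit eigenvectors of $\sigma_y$. Let $\mathfrak{A}=\bigotimes_{i\in\mathbb{N}}M_2(\mathbb{C})$ be the $C^*$-algebraic infinite tensor product, let $\mathfrak{B}$ be a copy of $\mathfrak{A}$, and let $\mathfrak{A}\otimes\mathfrak{B}$ be their $C^*$-tensor product. For $A\in M_2(\mathbb{C})$ let $A^{(i)}\in\mathfrak{A}$ denote $A$ placed at the $i$-th site. The state space of a unital $C^*$-algebra carries the weak* topology and its Borel $\sigma$-algebra; measures on it are positive and regular, and the barycenter of a probability measure $\nu$ on it is the state $a\mapsto\int\omega(a)\,d\nu(\omega)$. (i) For $b\in\{0,1\}$ and $s\in(\mathbb{Z}_2)^{\omega}$ there is a unique state $|b,s\rangle=\bigotimes_{i}|b,s(i)\rangle$ of $\mathfrak{A}$ such that $|b,s\rangle\big(\prod_{i<n}A_i^{(i)}\big)=\prod_{i<n}\langle b,s(i)|A_i|b,s(i)\rangle$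 for all $n$ and all $A_i\in M_2(\mathbb{C})$. There is a unique state $|b,s\rangle_A\otimes|b,s\rangle_B$ of $\mathfrak{A}\otimes\mathfrak{B}$ whose value at each $x\otimes y$ with $x\in\mathfrak{A}$, $y\in\mathfrak{B}$ is the product of the values of $|b,s\rangle$ at $x$ and at $y$. Moreover, $\mathfrak{B}$ has a unique tracial state $\tau$. (ii) Let $\mu$ be the normalized Haar measure on $(\mathbb{Z}_2)^{\omega}$. For each $b\in\{0,1\}$ there is a regular Borel probability measure $\mu_b$ on the state space of $\mathfrak{A}\otimes\mathfrak{B}$ such that, for every Borel set $S\subseteq(\mathbb{Z}_2)^{\omega}$, the set $\{|b,s\rangle_A\otimes|b,s\rangle_B : s\in S\}$ is Borel and $$\mu_b\big(\{|b,s\rangle_A\otimes|b,s\rangle_B : s\in S\}\big)=\mu(S).$$ Furthermore, $\mu_b$ has a barycenter $\rho_b$, and $\rho_b|_{I\otimes\mathfrak{B}}$ is the tracial state: $\rho_b(I\otimes y)=\tau(y)$ for all $y\in\mathfrak{B}$. In particular, $\rho_0$ and $\rho_1$ have the same restriction to $I\otimes\mathfrak{B}$. -/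

import Mathlib

open MeasureTheory
open scoped TensorProduct Matrix ComplexOrder

noncomputable section

/-! ### States of a unital C⋆-algebra -/

section States

variable {A : Type*} [CStarAlgebra A]

/-- The state space of a unital C⋆-algebra: positive normalised continuous linear functionals. -/
def StateSpace (A : Type*) [CStarAlgebra A] : Type _ :=
  {φ : WeakDual ℂ A // (∀ a : A, 0 ≤ φ (star a * a)) ∧ φ 1 = 1}

namespace StateSpace

instance : FunLike (StateSpace A) A ℂ where
  coe ω := ω.1
  coe_injective _ _ h := Subtype.ext (DFunLike.coe_injective h)

/-- The weak-⋆ topology. -/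
instance : TopologicalSpace (StateSpace A) :=
  instTopologicalSpaceSubtype

/-- The Borel σ-algebra of the weak-⋆ topology. -/
instance : MeasurableSpace (StateSpace A) := borel _

instance : BorelSpace (StateSpace A) := ⟨rfl⟩

/-- A state is tracial if it vanishes on commutators. -/
def IsTracial (ω : StateSpace A) : Prop :=
  ∀ a b : A, ω (a * b) = ω (b * a)

/-- `ρ` is the barycenter `ν(K)⁻¹ ∫ ω dν(ω)` of the measure `ν` on the state space `K`; the
integral is taken in the weak-⋆ sense. -/
def IsBarycenter (ν : Measure (StateSpace A)) (ρ : StateSpace A) : Prop :=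
  ∀ a : A, Integrable (fun ω : StateSpace A => ω a) ν ∧
    ρ a = ((ν.real Set.univ)⁻¹ : ℝ) • ∫ ω, ω a ∂ν

end StateSpace

end States

/-! ### The tensor product of two concrete C⋆-algebras -/

section Tensor

variable {H K : Type*} [NormedAddCommGroup H] [InnerProductSpace ℂ H]
  [NormedAddCommGroup K] [InnerProductSpace ℂ K]

/-- The Hilbert space tensor product: the completion of the algebraic tensor product with
`⟪x ⊗ y, x' ⊗ y'⟫ = ⟪x, x'⟫ ⟪y, y'⟫`. -/
def HilbertTensor (H K : Type*) [NormedAddCommGroup H] [InnerProductSpace ℂ H]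
    [NormedAddCommGroup K] [InnerProductSpace ℂ K] : Type _ :=
  UniformSpace.Completion (H ⊗[ℂ] K)

instance : NormedAddCommGroup (HilbertTensor H K) :=
  inferInstanceAs (NormedAddCommGroup (UniformSpace.Completion (H ⊗[ℂ] K)))

instance : InnerProductSpace ℂ (HilbertTensor H K) :=
  inferInstanceAs (InnerProductSpace ℂ (UniformSpace.Completion (H ⊗[ℂ] K)))

instance : CompleteSpace (HilbertTensor H K) :=
  inferInstanceAs (CompleteSpace (UniformSpace.Completion (H ⊗[ℂ] K)))

/-- The canonical isometric embedding of the algebraic tensor product, with dense range. -/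
def toHilbertTensor (H K : Type*) [NormedAddCommGroup H] [InnerProductSpace ℂ H]
    [NormedAddCommGroup K] [InnerProductSpace ℂ K] : H ⊗[ℂ] K →ₗᵢ[ℂ] HilbertTensor H K :=
  UniformSpace.Completion.toComplₗᵢ

/-- The operator `a ⊗ b` on the Hilbert space tensor product: the continuous extension of
`x ⊗ y ↦ a x ⊗ b y`. -/
def opTensor (a : H →L[ℂ] H) (b : K →L[ℂ] K) : HilbertTensor H K →L[ℂ] HilbertTensor H K :=
  ((toHilbertTensor H K).toContinuousLinearMap ∘L TensorProduct.mapL a b).extend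
    (toHilbertTensor H K).toContinuousLinearMap

theorem denseRange_toHilbertTensor (H K : Type*) [NormedAddCommGroup H] [InnerProductSpace ℂ H]
    [NormedAddCommGroup K] [InnerProductSpace ℂ K] : DenseRange (toHilbertTensor H K) :=
  UniformSpace.Completion.denseRange_coe

theorem opTensor_coe (a : H →L[ℂ] H) (b : K →L[ℂ] K) (z : H ⊗[ℂ] K) :
    opTensor a b (toHilbertTensor H K z) = toHilbertTensor H K (TensorProduct.mapL a b z) :=
  ContinuousLinearMap.extend_eq
    (f := (toHilbertTensor H K).toContinuousLinearMap ∘L TensorProduct.mapL a b)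
    (e := (toHilbertTensor H K).toContinuousLinearMap)
    (denseRange_toHilbertTensor H K) (toHilbertTensor H K).isometry.isUniformInducing z

variable [CompleteSpace H] [CompleteSpace K]

/-- The (spatial) C⋆-tensor product of C⋆-algebras of operators: the norm closure of the
⋆-algebra generated by the operators `a ⊗ b`. -/
def cstarTensor (A : StarSubalgebra ℂ (H →L[ℂ] H)) (B : StarSubalgebra ℂ (K →L[ℂ] K)) :
    StarSubalgebra ℂ (HilbertTensor H K →L[ℂ] HilbertTensor H K) :=
  (StarAlgebra.adjoin ℂ {T | ∃ a ∈ A, ∃ b ∈ B, T = opTensor a b}).topologicalClosure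

instance (A : StarSubalgebra ℂ (H →L[ℂ] H)) (B : StarSubalgebra ℂ (K →L[ℂ] K)) :
    IsClosed (cstarTensor A B : Set (HilbertTensor H K →L[ℂ] HilbertTensor H K)) :=
  StarSubalgebra.isClosed_topologicalClosure _

/-- The elementary tensor `a ⊗ b` as an element of the tensor product. -/
def elemTensor {A : StarSubalgebra ℂ (H →L[ℂ] H)} {B : StarSubalgebra ℂ (K →L[ℂ] K)}
    (a : A) (b : B) : cstarTensor A B :=
  ⟨opTensor a.1 b.1, StarSubalgebra.le_topologicalClosure _
    (StarAlgebra.subset_adjoin ℂ _ ⟨a.1, a.2, b.1, b.2, rfl⟩)⟩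

/-- `ω` is the product state `φ ⊗ ψ`: `ω(a ⊗ b) = φ(a) ψ(b)`. -/
def IsProductState {A : StarSubalgebra ℂ (H →L[ℂ] H)} {B : StarSubalgebra ℂ (K →L[ℂ] K)}
    [IsClosed (A : Set (H →L[ℂ] H))] [IsClosed (B : Set (K →L[ℂ] K))] (φ : StateSpace A) (ψ : StateSpace B)
    (ω : StateSpace (cstarTensor A B)) : Prop :=
  ∀ (a : A) (b : B), ω (elemTensor a b) = φ a * ψ b

end Tensor

/-! ### The qubit lattice algebra -/

/-- Configurations of the lattice that are `0` at all but finitely many sites. -/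
abbrev QubitConfig : Type := ℕ →₀ Fin 2

/-- The Hilbert space `ℓ²` over these configurations, i.e. the incomplete infinite tensor product
of copies of `ℂ²` along the reference vector `e₀ ⊗ e₀ ⊗ ⋯`. -/
abbrev QubitHilbert : Type := lp (fun _ : QubitConfig => ℂ) 2

/-- The formula for `A⁽ⁱ⁾ = I ⊗ ⋯ ⊗ I ⊗ A ⊗ I ⊗ ⋯` on functions of the configuration: the matrix
acts on the `i`-th coordinate. -/
def siteFun (i : ℕ) (M : Matrix (Fin 2) (Fin 2) ℂ) (f : QubitConfig → ℂ) (x : QubitConfig) : ℂ :=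
  ∑ k, M (x i) k * f (x.update i k)

theorem siteFun_eq (i : ℕ) (M : Matrix (Fin 2) (Fin 2) ℂ) (f : QubitConfig → ℂ)
    (x : QubitConfig) :
    siteFun i M f x = ∑ k, M (x i) (x i + k) * f (x + Finsupp.single i k) := by
  unfold siteFun
  rw [← Equiv.sum_comp (Equiv.addLeft (x i))]
  refine Finset.sum_congr rfl fun k _ => ?_
  have : x.update i (x i + k) = x + Finsupp.single i k := by
    ext j
    by_cases h : j = i
    · subst h; simp
    · simp [h]
  simp [this]

theorem memℓp_siteFun (i : ℕ) (M : Matrix (Fin 2) (Fin 2) ℂ) {f : QubitConfig → ℂ}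
    (hf : Memℓp f 2) : Memℓp (siteFun i M f) 2 := by
  have h2 : (0 : ℝ) < (2 : ENNReal).toReal := by norm_num
  have h : siteFun i M f = fun x => ∑ k ∈ Finset.univ,
      M (x i) (x i + k) * f (x + Finsupp.single i k) := by
    ext x; exact siteFun_eq i M f x
  rw [h]
  refine Memℓp.finsetSum (E := fun _ : QubitConfig => ℂ) Finset.univ
    (f := fun k x => M (x i) (x i + k) * f (x + Finsupp.single i k)) fun k _ => ?_
  have hk : Memℓp (fun x => f (x + Finsupp.single i k)) 2 := by
    rw [memℓp_gen_iff h2] at hf ⊢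
    exact (Equiv.addRight (Finsupp.single i k)).summable_iff.2 hf
  have hk' := hk.const_mul ((∑ p, ∑ q, ‖M p q‖ : ℝ) : ℂ)
  refine hk'.mono' fun x => ?_
  have hb : ‖M (x i) (x i + k)‖ ≤ ∑ p, ∑ q, ‖M p q‖ :=
    (Finset.single_le_sum (f := fun q => ‖M (x i) q‖) (fun _ _ => norm_nonneg _)
      (Finset.mem_univ _)).trans
      (Finset.single_le_sum (f := fun p => ∑ q, ‖M p q‖)
        (fun _ _ => Finset.sum_nonneg fun _ _ => norm_nonneg _) (Finset.mem_univ _))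
  rw [norm_mul, norm_mul]
  refine mul_le_mul_of_nonneg_right (hb.trans ?_) (norm_nonneg _)
  rw [Complex.norm_real]
  exact le_abs_self _

/-- `A⁽ⁱ⁾` as a linear map on the lattice Hilbert space. -/
def siteLin (i : ℕ) (M : Matrix (Fin 2) (Fin 2) ℂ) : QubitHilbert →ₗ[ℂ] QubitHilbert where
  toFun f := ⟨siteFun i M f, memℓp_siteFun i M (lp.memℓp f)⟩
  map_add' f g := by
    ext x
    change siteFun i M (f + g : QubitHilbert) x = siteFun i M f x + siteFun i M g x
    simp [siteFun, mul_add]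
    ring
  map_smul' c f := by
    ext x
    change siteFun i M (c • f : QubitHilbert) x = c * siteFun i M f x
    simp [siteFun]
    ring

theorem continuous_siteLin (i : ℕ) (M : Matrix (Fin 2) (Fin 2) ℂ) :
    Continuous (siteLin i M) := by
  refine (siteLin i M).continuous_of_seq_closed_graph fun u f g hu hg => ?_
  ext x
  have h1 : ∀ y : QubitConfig, Continuous fun h : QubitHilbert => h y := fun y =>
    (lp.evalCLM ℂ (fun _ : QubitConfig => ℂ) 2 y).continuous
  have h3 := ((h1 x).tendsto g).comp hg
  have h4 : Continuous fun h : QubitHilbert => siteFun i M h x :=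
    continuous_finsetSum _ fun k _ => continuous_const.mul (h1 _)
  exact tendsto_nhds_unique h3 ((h4.tendsto f).comp hu)

/-- `A⁽ⁱ⁾` as a bounded operator on the lattice Hilbert space. -/
def siteOp (i : ℕ) (M : Matrix (Fin 2) (Fin 2) ℂ) : QubitHilbert →L[ℂ] QubitHilbert :=
  ⟨siteLin i M, continuous_siteLin i M⟩

/-- The C⋆-algebra `⨂_{i ∈ ℕ} M₂` of the one-dimensional qubit lattice: the norm closure of the
⋆-algebra generated by all the one-site observables `A⁽ⁱ⁾`. -/
def qubitLattice : StarSubalgebra ℂ (QubitHilbert →L[ℂ] QubitHilbert) :=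
  (StarAlgebra.adjoin ℂ {T | ∃ i M, T = siteOp i M}).topologicalClosure

instance : IsClosed (qubitLattice : Set (QubitHilbert →L[ℂ] QubitHilbert)) :=
  StarSubalgebra.isClosed_topologicalClosure _

/-- `A⁽ⁱ⁾` as an element of the lattice algebra. -/
def site (i : ℕ) (M : Matrix (Fin 2) (Fin 2) ℂ) : qubitLattice :=
  ⟨siteOp i M, StarSubalgebra.le_topologicalClosure _
    (StarAlgebra.subset_adjoin ℂ _ ⟨i, M, rfl⟩)⟩

/-- `φ` is the product state `⨂ᵢ |ξᵢ⟩` given by a sequence of vectors of `ℂ²`: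
`φ(A₀ ⊗ ⋯ ⊗ Aₙ₋₁ ⊗ I ⊗ ⋯) = ∏ᵢ ⟨ξᵢ, Aᵢ ξᵢ⟩`. -/
def IsProductOfKets (ξ : ℕ → EuclideanSpace ℂ (Fin 2)) (φ : StateSpace qubitLattice) : Prop :=
  ∀ (n : ℕ) (M : ℕ → Matrix (Fin 2) (Fin 2) ℂ),
    φ ((List.range n).map fun i => site i (M i)).prod =
      ∏ i ∈ Finset.range n, inner ℂ (ξ i) (Matrix.toEuclideanLin (M i) (ξ i))

/-- The algebra `𝔄 ⊗ 𝔅` of two qubit lattices. -/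
abbrev qubitLatticePair :
    StarSubalgebra ℂ (HilbertTensor QubitHilbert QubitHilbert →L[ℂ]
      HilbertTensor QubitHilbert QubitHilbert) :=
  cstarTensor qubitLattice qubitLattice

/-- The Pauli matrix `σ_x`. -/
def pauliX : Matrix (Fin 2) (Fin 2) ℂ := !![0, 1; 1, 0]

/-- The Pauli matrix `σ_y`. -/
def pauliY : Matrix (Fin 2) (Fin 2) ℂ := !![0, -Complex.I; Complex.I, 0]

end

/-!
The elementary tensors `A₀ ⊗ ⋯ ⊗ Aₙ₋₁ ⊗ I ⊗ ⋯` span a dense subspace of the lattice algebra, so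
states, their weak-⋆ limits and traciality are all controlled by their values there. The vectors
`ξ₀ ⊗ ⋯ ⊗ ξₙ₋₁ ⊗ e₀ ⊗ ⋯` define vector states with the prescribed values on every elementary
tensor of length at most `n`; a weak-⋆ limit point is the state `⨂ᵢ |ξᵢ⟩`, and limits of vector
states of the tensor product Hilbert space give the product states of `𝔄 ⊗ 𝔅`.

For fixed `b` the map `s ↦ |b, s⟩ ⊗ |b, s⟩` from the Cantor group to the state space is continuous
and injective, hence a closed embedding, and `ν` is the image of the Haar measure. Under the Haar
measure the coordinates of `s` are independent and uniform, and averaging `⟨v, A v⟩` over an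
orthonormal basis `v` of `ℂ²` gives `tr A / 2` for every basis. So the barycenter restricts to
the functional `∏ᵢ tr Aᵢ / 2` on elementary tensors, which is the only tracial state since a
linear functional on matrices that vanishes on commutators is a multiple of the trace.
-/

open Filter Topology

section PositiveFunctional

variable {A : Type*} [CStarAlgebra A]

theorem norm_apply_le_of_star_mul_self_nonneg {f : A →ₗ[ℂ] ℂ}
    (hf : ∀ a, 0 ≤ f (star a * a)) (a : A) : ‖f a‖ ≤ ‖f 1‖ * ‖a‖ := by
  let := CStarAlgebra.spectralOrder A
  have := CStarAlgebra.spectralOrderedRing A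
  let F : A →ₚ[ℂ] ℂ := .mk₀ f fun x hx => by
    obtain ⟨b, rfl⟩ := CStarAlgebra.nonneg_iff_eq_star_mul_self.1 hx
    exact hf b
  have hF (b : A) : F b = f b := rfl
  have norm_sq (b : A) : ‖F.toPreGNS b‖ ^ 2 = ‖f (star b * b)‖ := by
    simpa [hF] using congrArg norm (F.preGNS_norm_sq (F.toPreGNS b))
  have cauchy_schwarz : ‖f a‖ ≤ ‖F.toPreGNS 1‖ * ‖F.toPreGNS a‖ := by
    simpa [F.preGNS_inner_def, hF] using norm_inner_le_norm (𝕜 := ℂ) (F.toPreGNS 1) (F.toPreGNS a)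
  have norm_star_mul_self : ‖f (star a * a)‖ ≤ ‖f 1‖ * ‖a‖ ^ 2 := by
    rw [sq, ← CStarRing.norm_star_mul_self]
    exact F.norm_apply_le_of_nonneg _ (star_mul_self_nonneg a)
  refine le_of_sq_le_sq ?_ (by positivity)
  calc ‖f a‖ ^ 2 ≤ (‖F.toPreGNS 1‖ * ‖F.toPreGNS a‖) ^ 2 := by gcongr
    _ = ‖f 1‖ * ‖f (star a * a)‖ := by rw [mul_pow, norm_sq, norm_sq, star_one, one_mul]
    _ ≤ ‖f 1‖ * (‖f 1‖ * ‖a‖ ^ 2) := by gcongr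
    _ = (‖f 1‖ * ‖a‖) ^ 2 := by ring

end PositiveFunctional

namespace StateSpace

variable {A : Type*} [CStarAlgebra A]

instance : ContinuousLinearMapClass (StateSpace A) ℂ A ℂ where
  map_add ω := map_add ω.1
  map_smulₛₗ ω := map_smulₛₗ ω.1
  map_continuous ω := ω.1.cont

protected theorem map_one (ω : StateSpace A) : ω 1 = 1 := ω.2.2

theorem map_star_mul_self_nonneg (ω : StateSpace A) (a : A) : 0 ≤ ω (star a * a) := ω.2.1 a

theorem norm_apply_le (ω : StateSpace A) (a : A) : ‖ω a‖ ≤ ‖a‖ := by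
  simpa [ω.map_one] using
    norm_apply_le_of_star_mul_self_nonneg (f := (ω : A →ₗ[ℂ] ℂ)) ω.map_star_mul_self_nonneg a

/-- The state given by a positive normalised linear functional, whose continuity is automatic. -/
noncomputable def ofLinearMap (f : A →ₗ[ℂ] ℂ) (hpos : ∀ a, 0 ≤ f (star a * a)) (hone : f 1 = 1) :
    StateSpace A :=
  ⟨StrongDual.toWeakDual (f.mkContinuous ‖f 1‖ (norm_apply_le_of_star_mul_self_nonneg hpos)),
    hpos, hone⟩

theorem continuous_eval (a : A) : Continuous fun ω : StateSpace A => ω a :=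
  (WeakDual.eval_continuous a).comp continuous_subtype_val

instance : T2Space (StateSpace A) :=
  inferInstanceAs (T2Space {φ : WeakDual ℂ A // (∀ a : A, 0 ≤ φ (star a * a)) ∧ φ 1 = 1})

instance : CompactSpace (StateSpace A) := by
  refine isCompact_iff_compactSpace.1 (WeakDual.isCompact_of_bounded_of_closed ?_ ?_)
  · refine (WeakDual.isBounded_closedBall (0 : StrongDual ℂ A) 1).subset fun φ hφ => ?_
    rw [Set.mem_preimage, mem_closedBall_zero_iff]
    exact ContinuousLinearMap.opNorm_le_bound _ zero_le_one fun a =>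
      (norm_apply_le ⟨φ, hφ⟩ a).trans_eq (one_mul _).symm
  · have isClosed_pos : IsClosed {φ : WeakDual ℂ A | ∀ a, 0 ≤ φ (star a * a)} := by
      rw [Set.ofPred_forall]
      exact isClosed_iInter fun _ =>
        isClosed_le continuous_const (WeakDual.eval_continuous _)
    exact isClosed_pos.inter (isClosed_eq (WeakDual.eval_continuous 1) continuous_const)

theorem exists_apply_eq_of_tendsto {ι : Type*} (l : Filter ι) [l.NeBot] (ω : ι → StateSpace A) :
    ∃ φ : StateSpace A, ∀ a z, Tendsto (fun i => ω i a) l (𝓝 z) → φ a = z := by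
  let F := (Ultrafilter.of l).map ω
  refine ⟨F.lim, fun a z hz => ?_⟩
  have h : Tendsto (fun i => ω i a) (Ultrafilter.of l) (𝓝 (F.lim a)) :=
    ((continuous_eval a).tendsto _).comp F.le_nhds_lim
  exact tendsto_nhds_unique h (hz.mono_left (Ultrafilter.of_le l))

theorem integrable_eval (ν : Measure (StateSpace A)) [IsFiniteMeasure ν] (a : A) :
    Integrable (fun ω : StateSpace A => ω a) ν :=
  (continuous_eval a).integrable_of_hasCompactSupport (HasCompactSupport.of_compactSpace _)

theorem exists_isBarycenter (ν : Measure (StateSpace A)) [IsFiniteMeasure ν] [NeZero ν] :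
    ∃ ρ, IsBarycenter ν ρ := by
  let f : A →ₗ[ℂ] ℂ :=
    { toFun a := ⨍ ω, ω a ∂ν
      map_add' a b := by
        simp only [map_add, average_eq, integral_add (integrable_eval ν a) (integrable_eval ν b),
          smul_add]
      map_smul' c a := by
        simp only [map_smul, average_eq, integral_smul, smul_comm c, RingHom.id_apply] }
  refine ⟨ofLinearMap f (fun a => ?_) ?_, fun a => ⟨integrable_eval ν a, average_eq _ _⟩⟩
  · exact integral_nonneg fun ω => ω.map_star_mul_self_nonneg a
  · change ⨍ ω : StateSpace A, ω 1 ∂ν = 1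
    simp only [StateSpace.map_one, average_const]

theorem IsBarycenter.apply_eq_integral {X : Type*} [MeasurableSpace X] {μ : Measure X}
    [IsProbabilityMeasure μ] {f : X → StateSpace A} (hf : AEMeasurable f μ) {ρ : StateSpace A}
    (hρ : IsBarycenter (μ.map f) ρ) (a : A) : ρ a = ∫ x, f x a ∂μ := by
  have : IsProbabilityMeasure (μ.map f) := Measure.isProbabilityMeasure_map hf
  rw [(hρ a).2, probReal_univ, inv_one, one_smul, integral_map hf (hρ a).1.aestronglyMeasurable]

section DenseSpan

variable {G : Set A}

theorem ext_of_dense_span (hG : Dense (Submodule.span ℂ G : Set A))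
    {φ ψ : StateSpace A} (h : ∀ a ∈ G, φ a = ψ a) : φ = ψ :=
  Subtype.ext (ContinuousLinearMap.ext_on hG h)

theorem isEmbedding_restrict (hG : Dense (Submodule.span ℂ G : Set A)) :
    IsEmbedding fun (ω : StateSpace A) (a : G) => ω a := by
  refine Continuous.isClosedEmbedding ?_ ?_ |>.isEmbedding
  · exact continuous_pi fun a => continuous_eval (a : A)
  · exact fun φ ψ h => ext_of_dense_span hG fun a ha => congrFun h ⟨a, ha⟩

theorem continuous_of_dense_span (hG : Dense (Submodule.span ℂ G : Set A))
    {X : Type*} [TopologicalSpace X] {f : X → StateSpace A}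
    (hf : ∀ a ∈ G, Continuous fun x => f x a) : Continuous f :=
  (isEmbedding_restrict hG).continuous_iff.2 (continuous_pi fun a => hf a a.2)

theorem tendsto_of_dense_span (hG : Dense (Submodule.span ℂ G : Set A)) {ι : Type*}
    {l : Filter ι} {f : ι → StateSpace A} {φ : StateSpace A}
    (hf : ∀ a ∈ G, Tendsto (fun i => f i a) l (𝓝 (φ a))) : Tendsto f l (𝓝 φ) :=
  (isEmbedding_restrict hG).tendsto_nhds_iff.2 (tendsto_pi_nhds.2 fun a => hf a a.2)

theorem isTracial_of_dense_span (hG : Dense (Submodule.span ℂ G : Set A))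
    {σ : StateSpace A} (h : ∀ a ∈ G, ∀ b ∈ G, σ (a * b) = σ (b * a)) : σ.IsTracial := by
  let B : A →L[ℂ] A →L[ℂ] ℂ :=
    .compL ℂ A A ℂ (WeakDual.toStrongDual σ.1) ∘L .mul ℂ A
  have hB : B = B.flip := ContinuousLinearMap.ext_on hG fun a ha =>
    ContinuousLinearMap.ext_on hG fun b hb => h a ha b hb
  exact fun a b => DFunLike.congr_fun (DFunLike.congr_fun hB a) b

end DenseSpan

section Vector

variable {H : Type*} [NormedAddCommGroup H] [InnerProductSpace ℂ H] [CompleteSpace H]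

/-- The vector state `a ↦ ⟪v, a v⟫` of a C⋆-algebra of operators. -/
noncomputable def ofVector (S : StarSubalgebra ℂ (H →L[ℂ] H)) [IsClosed (S : Set (H →L[ℂ] H))]
    (v : H) (hv : ‖v‖ = 1) : StateSpace S :=
  ofLinearMap
    { toFun a := inner ℂ v (a.1 v)
      map_add' _ _ := inner_add_right _ _ _
      map_smul' _ _ := inner_smul_right _ _ _ }
    (fun a => by
      change 0 ≤ inner ℂ v (star a.1 (a.1 v))
      rw [ContinuousLinearMap.star_eq_adjoint, ContinuousLinearMap.adjoint_inner_right]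
      rw [inner_self_eq_norm_sq_to_K, ← RCLike.ofReal_pow]
      exact Complex.zero_le_real.2 (sq_nonneg _))
    (inner_self_eq_one_of_norm_eq_one (𝕜 := ℂ) hv)

end Vector

end StateSpace

theorem dense_span_of_union_star_subset {R B : Type*} [CommSemiring R] [StarRing R]
    [TopologicalSpace B] [Semiring B] [IsTopologicalSemiring B] [Algebra R B] [StarRing B]
    [ContinuousStar B] [StarModule R B] {s : Set B} {S : StarSubalgebra R B}
    (hS : S = (StarAlgebra.adjoin R s).topologicalClosure) (N : Submonoid S)
    (hs : s ∪ star s ⊆ S.subtype '' N) : Dense (Submodule.span R (N : Set S) : Set S) := by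
  have closure_le : Submonoid.closure (s ∪ star s) ≤ N.map S.subtype :=
    Submonoid.closure_le.2 hs
  have adjoin_le :
      (StarAlgebra.adjoin R s : Set B) ⊆ S.subtype '' Submodule.span R (N : Set S) := by
    intro x hx
    have hx : x ∈ Submodule.span R (Submonoid.closure (s ∪ star s) : Set B) := by
      rwa [← StarAlgebra.adjoin_eq_span]
    exact (Submodule.map_span S.subtype.toAlgHom.toLinearMap (N : Set S)).ge
      (Submodule.span_mono closure_le hx)
  refine Subtype.dense_iff.2 fun x hx => ?_
  rw [hS] at hx
  exact closure_mono adjoin_le hx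

section Tensor

variable {H K : Type*} [NormedAddCommGroup H] [InnerProductSpace ℂ H]
  [NormedAddCommGroup K] [InnerProductSpace ℂ K]

theorem hilbertTensor_ext {E : Type*} [NormedAddCommGroup E] [NormedSpace ℂ E]
    {f g : HilbertTensor H K →L[ℂ] E}
    (h : ∀ x y, f (toHilbertTensor H K (x ⊗ₜ y)) = g (toHilbertTensor H K (x ⊗ₜ y))) : f = g := by
  have comp_eq : f.toLinearMap ∘ₗ (toHilbertTensor H K).toLinearMap =
      g.toLinearMap ∘ₗ (toHilbertTensor H K).toLinearMap := TensorProduct.ext' h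
  exact DFunLike.coe_injective ((denseRange_toHilbertTensor H K).equalizer f.continuous
    g.continuous (funext (DFunLike.congr_fun comp_eq)))

theorem opTensor_tmul (a : H →L[ℂ] H) (b : K →L[ℂ] K) (x : H) (y : K) :
    opTensor a b (toHilbertTensor H K (x ⊗ₜ y)) = toHilbertTensor H K (a x ⊗ₜ b y) :=
  opTensor_coe a b (x ⊗ₜ y)

theorem inner_toHilbertTensor_tmul (x x' : H) (y y' : K) :
    inner ℂ (toHilbertTensor H K (x ⊗ₜ y)) (toHilbertTensor H K (x' ⊗ₜ y')) =
      inner ℂ x x' * inner ℂ y y' := by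
  rw [LinearIsometry.inner_map_map, TensorProduct.inner_tmul]

theorem opTensor_one : opTensor (1 : H →L[ℂ] H) (1 : K →L[ℂ] K) = 1 :=
  hilbertTensor_ext fun x y => opTensor_tmul 1 1 x y

theorem opTensor_mul (a a' : H →L[ℂ] H) (b b' : K →L[ℂ] K) :
    opTensor (a * a') (b * b') = opTensor a b * opTensor a' b' :=
  hilbertTensor_ext fun x y => by simp only [mul_apply_eq_comp, opTensor_tmul]

variable [CompleteSpace H] [CompleteSpace K]

theorem star_opTensor (a : H →L[ℂ] H) (b : K →L[ℂ] K) :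
    star (opTensor a b) = opTensor (star a) (star b) := by
  refine hilbertTensor_ext fun x y => ?_
  refine (InnerProductSpace.toDual ℂ _).injective (hilbertTensor_ext fun x' y' => ?_)
  simp only [InnerProductSpace.toDual_apply_apply, ContinuousLinearMap.star_eq_adjoint,
    ContinuousLinearMap.adjoint_inner_left, opTensor_tmul, inner_toHilbertTensor_tmul]

variable {A : StarSubalgebra ℂ (H →L[ℂ] H)} {B : StarSubalgebra ℂ (K →L[ℂ] K)}

/-- The map `(a, b) ↦ a ⊗ b` as a homomorphism of multiplicative monoids. -/
noncomputable def elemTensorHom (A : StarSubalgebra ℂ (H →L[ℂ] H))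
    (B : StarSubalgebra ℂ (K →L[ℂ] K)) : A × B →* cstarTensor A B where
  toFun p := elemTensor p.1 p.2
  map_one' := Subtype.ext opTensor_one
  map_mul' _ _ := Subtype.ext (opTensor_mul _ _ _ _)

theorem dense_span_range_elemTensor :
    Dense (Submodule.span ℂ (Set.range fun p : A × B => elemTensor p.1 p.2) :
      Set (cstarTensor A B)) := by
  refine dense_span_of_union_star_subset rfl (MonoidHom.mrange (elemTensorHom A B)) ?_
  rintro T (⟨a, ha, b, hb, rfl⟩ | ⟨a, ha, b, hb, hT⟩)
  · exact ⟨_, ⟨(⟨a, ha⟩, ⟨b, hb⟩), rfl⟩, rfl⟩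
  · refine ⟨_, ⟨(⟨star a, star_mem ha⟩, ⟨star b, star_mem hb⟩), rfl⟩, ?_⟩
    exact (star_opTensor a b).symm.trans (by rw [← hT, star_star])

variable [IsClosed (A : Set (H →L[ℂ] H))] [IsClosed (B : Set (K →L[ℂ] K))]

namespace IsProductState

theorem unique {φ : StateSpace A} {ψ : StateSpace B} {ω ω' : StateSpace (cstarTensor A B)}
    (hω : IsProductState φ ψ ω) (hω' : IsProductState φ ψ ω') : ω = ω' := by
  refine StateSpace.ext_of_dense_span dense_span_range_elemTensor ?_
  rintro _ ⟨⟨a, b⟩, rfl⟩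
  exact (hω a b).trans (hω' a b).symm

theorem apply_elemTensor_one {φ : StateSpace A} {ψ : StateSpace B}
    {ω : StateSpace (cstarTensor A B)} (hω : IsProductState φ ψ ω) (b : B) :
    ω (elemTensor 1 b) = ψ b := by
  rw [hω, φ.map_one, one_mul]

theorem continuous {X : Type*} [TopologicalSpace X] {φ : X → StateSpace A} {ψ : X → StateSpace B}
    {ω : X → StateSpace (cstarTensor A B)} (hφ : Continuous φ) (hψ : Continuous ψ)
    (hω : ∀ x, IsProductState (φ x) (ψ x) (ω x)) : Continuous ω := by
  refine StateSpace.continuous_of_dense_span dense_span_range_elemTensor ?_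
  rintro _ ⟨⟨a, b⟩, rfl⟩
  simp only [fun x => hω x a b]
  exact ((StateSpace.continuous_eval a).comp hφ).mul ((StateSpace.continuous_eval b).comp hψ)

end IsProductState

theorem isProductState_ofVector {x : H} {y : K} (hx : ‖x‖ = 1) (hy : ‖y‖ = 1) :
    IsProductState (StateSpace.ofVector A x hx) (StateSpace.ofVector B y hy)
      (StateSpace.ofVector (cstarTensor A B) (toHilbertTensor H K (x ⊗ₜ y))
        (by rw [LinearIsometry.norm_map, TensorProduct.norm_tmul, hx, hy, one_mul])) := by
  intro a b
  change inner ℂ _ (opTensor a.1 b.1 _) = inner ℂ x (a.1 x) * inner ℂ y (b.1 y)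
  rw [opTensor_tmul, inner_toHilbertTensor_tmul]

theorem exists_isProductState_of_tendsto {ι : Type*} {l : Filter ι} [l.NeBot]
    {φ : StateSpace A} {ψ : StateSpace B} {φ' : ι → StateSpace A} {ψ' : ι → StateSpace B}
    {ω' : ι → StateSpace (cstarTensor A B)} (hφ : Tendsto φ' l (𝓝 φ)) (hψ : Tendsto ψ' l (𝓝 ψ))
    (hω' : ∀ i, IsProductState (φ' i) (ψ' i) (ω' i)) : ∃ ω, IsProductState φ ψ ω := by
  obtain ⟨ω, hω⟩ := StateSpace.exists_apply_eq_of_tendsto l ω'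
  refine ⟨ω, fun a b => hω _ _ ?_⟩
  simp only [fun i => hω' i a b]
  exact (((StateSpace.continuous_eval a).tendsto φ).comp hφ).mul
    (((StateSpace.continuous_eval b).tendsto ψ).comp hψ)

end Tensor

section SiteOperators

variable (i : ℕ) (M N : Matrix (Fin 2) (Fin 2) ℂ)

theorem siteOp_apply (f : QubitHilbert) (x : QubitConfig) :
    siteOp i M f x = ∑ k, M (x i) k * f (x.update i k) := rfl

theorem siteOp_one : siteOp i 1 = 1 := by
  ext f x
  simp [siteOp_apply, Matrix.one_apply]

theorem siteOp_mul : siteOp i (M * N) = siteOp i M * siteOp i N := by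
  ext f x
  simp only [siteOp_apply, mul_apply_eq_comp, Matrix.mul_apply, Finset.mul_sum, Finset.sum_mul,
    Finsupp.update_apply, if_true, Finsupp.update_idem, mul_assoc]
  exact Finset.sum_comm

theorem siteOp_commute {i j : ℕ} (hij : i ≠ j) : Commute (siteOp i M) (siteOp j N) := by
  ext f x
  simp only [siteOp_apply, mul_apply_eq_comp, Finset.mul_sum, Finsupp.update_apply, if_neg hij,
    if_neg hij.symm, Finsupp.update_comm x hij, mul_left_comm (N _ _)]
  exact Finset.sum_comm

theorem siteOp_single (x : QubitConfig) :
    siteOp i M (lp.single 2 x 1) = ∑ k, M k (x i) • lp.single 2 (x.update i k) 1 := by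
  ext y
  rw [siteOp_apply, lp.coeFn_sum, Finset.sum_apply]
  by_cases hy : ∃ l, y = x.update i l
  · obtain ⟨l, rfl⟩ := hy
    have update_eq_self (k : Fin 2) : x.update i k = x ↔ k = x i := by
      simp [DFunLike.ext'_iff]
    have update_inj (k : Fin 2) : x.update i l = x.update i k ↔ l = k := by
      simpa [DFunLike.ext'_iff] using (Function.update_injective x i).eq_iff
    simp [-Fin.sum_univ_two, lp.single_apply, Pi.single_apply, update_eq_self, update_inj]
  · have update_ne (k : Fin 2) : y.update i k ≠ x := by
      rintro rfl
      exact hy ⟨y i, by simp⟩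
    have ne_update (k : Fin 2) : y ≠ x.update i k := fun h => hy ⟨k, h⟩
    simp [lp.single_apply, update_ne, ne_update]

theorem star_siteOp : star (siteOp i M) = siteOp i Mᴴ := by
  ext f x
  calc star (siteOp i M) f x = inner ℂ (lp.single 2 x 1) (star (siteOp i M) f) := by
        simp [lp.inner_single_left]
    _ = inner ℂ (siteOp i M (lp.single 2 x 1)) f := by
        rw [ContinuousLinearMap.star_eq_adjoint, ContinuousLinearMap.adjoint_inner_right]
    _ = siteOp i Mᴴ f x := by
        simp [siteOp_single, siteOp_apply, lp.inner_single_left, mul_comm]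

/-- The embedding `A ↦ A⁽ⁱ⁾` of the one-site algebra into the lattice algebra. -/
noncomputable def siteHom : Matrix (Fin 2) (Fin 2) ℂ →⋆ₐ[ℂ] qubitLattice where
  toFun := site i
  map_one' := Subtype.ext (siteOp_one i)
  map_mul' M N := Subtype.ext (siteOp_mul i M N)
  map_zero' := by
    ext f x
    change siteOp i 0 f x = 0
    simp [siteOp_apply]
  map_add' M N := by
    ext f x
    change siteOp i (M + N) f x = siteOp i M f x + siteOp i N f x
    simp only [siteOp_apply, Matrix.add_apply, add_mul, Finset.sum_add_distrib]
  commutes' c := by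
    ext f x
    change siteOp i (algebraMap ℂ _ c) f x = c * f x
    simp [siteOp_apply, Matrix.algebraMap_matrix_apply]
  map_star' M := Subtype.ext (star_siteOp i M).symm

theorem siteHom_commute {i j : ℕ} (hij : i ≠ j) : Commute (siteHom i M) (siteHom j N) :=
  Subtype.ext (siteOp_commute M N hij)

end SiteOperators

section SiteProducts

variable {n : ℕ} (M N : ℕ → Matrix (Fin 2) (Fin 2) ℂ)

/-- The elementary tensor `A₀ ⊗ ⋯ ⊗ Aₙ₋₁ ⊗ I ⊗ ⋯` of the lattice algebra. -/
noncomputable def siteProd (n : ℕ) (M : ℕ → Matrix (Fin 2) (Fin 2) ℂ) : qubitLattice :=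
  ((List.range n).map fun i => siteHom i (M i)).prod

theorem siteProd_zero : siteProd 0 M = 1 := by
  simp [siteProd]

theorem siteProd_succ : siteProd (n + 1) M = siteProd n M * siteHom n (M n) := by
  simp [siteProd, List.range_succ]

theorem siteProd_commute_siteHom {j : ℕ} (hj : n ≤ j) (A : Matrix (Fin 2) (Fin 2) ℂ) :
    Commute (siteProd n M) (siteHom j A) :=
  Commute.list_prod_left _ _ fun a ha => by
    obtain ⟨i, hi, rfl⟩ := List.mem_map.1 ha
    exact siteHom_commute _ _ ((List.mem_range.1 hi).trans_le hj).ne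

theorem siteProd_mul : siteProd n (M * N) = siteProd n M * siteProd n N := by
  induction n with
  | zero => simp only [siteProd_zero, mul_one]
  | succ n ih =>
    simp only [siteProd_succ, ih, Pi.mul_apply, map_mul]
    exact (siteProd_commute_siteHom N le_rfl (M n)).mul_mul_mul_comm _ _

theorem star_siteProd : star (siteProd n M) = siteProd n (star M) := by
  induction n with
  | zero => simp only [siteProd_zero, star_one]
  | succ n ih =>
    rw [siteProd_succ, siteProd_succ, star_mul, ih, ← map_star]
    exact (siteProd_commute_siteHom _ le_rfl _).symm

theorem siteProd_congr {M N : ℕ → Matrix (Fin 2) (Fin 2) ℂ} (h : ∀ i < n, M i = N i) :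
    siteProd n M = siteProd n N :=
  congrArg List.prod (List.map_congr_left fun i hi => by rw [h i (List.mem_range.1 hi)])

theorem siteProd_one : siteProd n 1 = 1 := by
  induction n with
  | zero => exact siteProd_zero 1
  | succ n ih => rw [siteProd_succ, ih, Pi.one_apply, map_one, mul_one]

theorem siteProd_single (i : ℕ) (A : Matrix (Fin 2) (Fin 2) ℂ) :
    siteProd (i + 1) (Pi.mulSingle i A) = siteHom i A := by
  rw [siteProd_succ, Pi.mulSingle_eq_same,
    siteProd_congr (N := 1) fun j hj => Pi.mulSingle_eq_of_ne hj.ne _,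
    siteProd_one, one_mul]

theorem siteProd_ite_of_le {m : ℕ} (hnm : n ≤ m) :
    siteProd m (fun i => if i < n then M i else 1) = siteProd n M := by
  induction m, hnm using Nat.le_induction with
  | base => exact siteProd_congr fun i hi => if_pos hi
  | succ m hm ih => rw [siteProd_succ, ih, if_neg hm.not_gt, map_one, mul_one]

end SiteProducts

/-- The elementary tensors of the lattice algebra, which are closed under multiplication. -/
noncomputable def siteProdSubmonoid : Submonoid qubitLattice where
  carrier := {a | ∃ n M, siteProd n M = a}
  one_mem' := ⟨0, 1, siteProd_zero 1⟩
  mul_mem' := by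
    rintro _ _ ⟨n, M, rfl⟩ ⟨m, N, rfl⟩
    exact ⟨max n m, _, (siteProd_mul _ _).trans (congrArg₂ _
      (siteProd_ite_of_le M (le_max_left n m)) (siteProd_ite_of_le N (le_max_right n m)))⟩

theorem dense_span_siteProdSubmonoid :
    Dense (Submodule.span ℂ (siteProdSubmonoid : Set qubitLattice) : Set qubitLattice) := by
  refine dense_span_of_union_star_subset rfl siteProdSubmonoid ?_
  rintro T (⟨i, A, rfl⟩ | ⟨i, A, hT⟩)
  · exact ⟨_, ⟨_, _, siteProd_single i A⟩, rfl⟩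
  · exact ⟨_, ⟨_, _, siteProd_single i Aᴴ⟩,
      (star_siteOp i A).symm.trans (by rw [← hT, star_star])⟩

section ProductVectors

/-- The reference vector `e₀ ⊗ e₀ ⊗ ⋯`. -/
noncomputable def refVector : QubitHilbert := lp.single 2 0 1

theorem siteHom_single_refVector (i : ℕ) :
    (siteHom i (Matrix.single 0 0 1)).1 refVector = refVector := by
  refine (siteOp_single i _ 0).trans ?_
  simp [Fin.sum_univ_two, refVector]

theorem inner_refVector_mul_siteHom {i : ℕ} {a : qubitLattice}
    (ha : Commute a (siteHom i (Matrix.single 0 0 1))) (A : Matrix (Fin 2) (Fin 2) ℂ) :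
    inner ℂ refVector ((a * siteHom i A).1 refVector) =
      A 0 0 * inner ℂ refVector (a.1 refVector) := by
  set e : qubitLattice := siteHom i (Matrix.single 0 0 1)
  have star_e : star e.1 = e.1 := congrArg Subtype.val <| (map_star (siteHom i) _).symm.trans
    (by rw [Matrix.star_eq_conjTranspose, Matrix.conjTranspose_single, star_one])
  have e_refVector : e.1 refVector = refVector := siteHom_single_refVector i
  have compress : e * (a * siteHom i A) * e = A 0 0 • (a * e) := by
    have single_mul_mul_single : Matrix.single 0 0 1 * A * Matrix.single 0 0 1 =
        A 0 0 • Matrix.single (0 : Fin 2) (0 : Fin 2) (1 : ℂ) := by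
      simp [Matrix.single_mul_mul_single]
    rw [← mul_assoc, ← ha.eq, mul_assoc a, mul_assoc a, ← map_mul, ← map_mul,
      single_mul_mul_single, map_smul, mul_smul_comm]
  calc inner ℂ refVector ((a * siteHom i A).1 refVector)
      = inner ℂ (e.1 refVector) ((a * siteHom i A).1 (e.1 refVector)) := by rw [e_refVector]
    _ = inner ℂ refVector ((e * (a * siteHom i A) * e).1 refVector) := by
      rw [← ContinuousLinearMap.adjoint_inner_right, ← ContinuousLinearMap.star_eq_adjoint, star_e]
      rfl
    _ = A 0 0 * inner ℂ refVector (a.1 refVector) := by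
      rw [compress, ← inner_smul_right]
      exact congrArg (fun v => inner ℂ refVector (A 0 0 • a.1 v)) e_refVector

theorem inner_refVector_siteProd (n : ℕ) (M : ℕ → Matrix (Fin 2) (Fin 2) ℂ) :
    inner ℂ refVector ((siteProd n M).1 refVector) = ∏ i ∈ Finset.range n, M i 0 0 := by
  induction n with
  | zero =>
    rw [siteProd_zero]
    change inner ℂ refVector refVector = _
    simp [refVector]
  | succ n ih =>
    rw [siteProd_succ, inner_refVector_mul_siteHom (siteProd_commute_siteHom M le_rfl _), ih,
      Finset.prod_range_succ, mul_comm]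

theorem conjTranspose_replicateCol_mul_mul_replicateCol_apply {m ι : Type*} [Fintype m]
    [DecidableEq m] (A : Matrix m m ℂ) (ξ : EuclideanSpace ℂ m) (i j : ι) :
    ((Matrix.replicateCol ι ξ)ᴴ * A * Matrix.replicateCol ι ξ) i j =
      inner ℂ ξ (Matrix.toEuclideanLin A ξ) := by
  rw [Matrix.mul_assoc, ← Matrix.replicateCol_mulVec, ← inner_matrix_col_col]
  rfl

variable {ξ : ℕ → EuclideanSpace ℂ (Fin 2)}

/-- The vector `ξ₀ ⊗ ⋯ ⊗ ξₙ₋₁ ⊗ e₀ ⊗ e₀ ⊗ ⋯`, obtained from the reference vector by applying at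
each site `i < n` a matrix that maps `e₀` to `ξᵢ`. -/
noncomputable def productVector (ξ : ℕ → EuclideanSpace ℂ (Fin 2)) (n : ℕ) : QubitHilbert :=
  (siteProd n fun i => Matrix.replicateCol (Fin 2) (ξ i)).1 refVector

theorem inner_productVector_siteProd (ξ : ℕ → EuclideanSpace ℂ (Fin 2)) (n : ℕ)
    (M : ℕ → Matrix (Fin 2) (Fin 2) ℂ) :
    inner ℂ (productVector ξ n) ((siteProd n M).1 (productVector ξ n)) =
      ∏ i ∈ Finset.range n, inner ℂ (ξ i) (Matrix.toEuclideanLin (M i) (ξ i)) := by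
  let K : ℕ → Matrix (Fin 2) (Fin 2) ℂ := fun i => Matrix.replicateCol (Fin 2) (ξ i)
  calc inner ℂ (productVector ξ n) ((siteProd n M).1 (productVector ξ n))
      = inner ℂ refVector ((star (siteProd n K) * siteProd n M * siteProd n K).1 refVector) := by
        rw [productVector, ← ContinuousLinearMap.adjoint_inner_right]
        rfl
    _ = ∏ i ∈ Finset.range n, inner ℂ (ξ i) (Matrix.toEuclideanLin (M i) (ξ i)) := by
        rw [star_siteProd, ← siteProd_mul, ← siteProd_mul, inner_refVector_siteProd]
        exact Finset.prod_congr rfl fun i _ =>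
          conjTranspose_replicateCol_mul_mul_replicateCol_apply (M i) (ξ i) 0 0

theorem inner_toEuclideanLin_one {m : Type*} [Fintype m] [DecidableEq m]
    (ξ : EuclideanSpace ℂ m) :
    inner ℂ ξ (Matrix.toEuclideanLin (1 : Matrix m m ℂ) ξ) = (‖ξ‖ : ℂ) ^ 2 := by
  rw [Matrix.toLpLin_one, LinearMap.id_apply]
  exact inner_self_eq_norm_sq_to_K ξ

theorem norm_productVector (hξ : ∀ i, ‖ξ i‖ = 1) (n : ℕ) : ‖productVector ξ n‖ = 1 := by
  have inner_self : inner ℂ (productVector ξ n) (productVector ξ n) = 1 := by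
    have h := inner_productVector_siteProd ξ n 1
    rw [siteProd_one] at h
    exact h.trans (Finset.prod_eq_one fun i _ => by simp [hξ])
  rw [@norm_eq_sqrt_re_inner ℂ, inner_self, RCLike.one_re, Real.sqrt_one]

theorem inner_productVector_siteProd_of_le (hξ : ∀ i, ‖ξ i‖ = 1) {n m : ℕ} (hnm : n ≤ m)
    (M : ℕ → Matrix (Fin 2) (Fin 2) ℂ) :
    inner ℂ (productVector ξ m) ((siteProd n M).1 (productVector ξ m)) =
      ∏ i ∈ Finset.range n, inner ℂ (ξ i) (Matrix.toEuclideanLin (M i) (ξ i)) := by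
  rw [← siteProd_ite_of_le M hnm, inner_productVector_siteProd,
    ← Finset.prod_subset (Finset.range_mono hnm)]
  · exact Finset.prod_congr rfl fun i hi => by rw [if_pos (Finset.mem_range.1 hi)]
  · intro i _ hi
    rw [if_neg (by simpa using hi), inner_toEuclideanLin_one, hξ]
    simp

theorem exists_isProductOfKets (hξ : ∀ i, ‖ξ i‖ = 1) : ∃ φ, IsProductOfKets ξ φ := by
  obtain ⟨φ, hφ⟩ := StateSpace.exists_apply_eq_of_tendsto atTop fun n =>
    StateSpace.ofVector qubitLattice (productVector ξ n) (norm_productVector hξ n)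
  refine ⟨φ, fun n M => hφ _ _ (tendsto_const_nhds.congr' ?_)⟩
  filter_upwards [eventually_ge_atTop n] with m hm
  exact (inner_productVector_siteProd_of_le hξ hm M).symm

end ProductVectors

namespace IsProductOfKets

variable {ξ η : ℕ → EuclideanSpace ℂ (Fin 2)} {φ ψ : StateSpace qubitLattice}

theorem apply_siteProd (hφ : IsProductOfKets ξ φ) (n : ℕ) (M : ℕ → Matrix (Fin 2) (Fin 2) ℂ) :
    φ (siteProd n M) =
      ∏ i ∈ Finset.range n, inner ℂ (ξ i) (Matrix.toEuclideanLin (M i) (ξ i)) :=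
  hφ n M

theorem unique (hφ : IsProductOfKets ξ φ) (hψ : IsProductOfKets ξ ψ) : φ = ψ := by
  refine StateSpace.ext_of_dense_span dense_span_siteProdSubmonoid ?_
  rintro _ ⟨n, M, rfl⟩
  rw [hφ.apply_siteProd, hψ.apply_siteProd]

theorem apply_siteHom (hφ : IsProductOfKets ξ φ) (i : ℕ) (A : Matrix (Fin 2) (Fin 2) ℂ) :
    φ (siteHom i A) = inner ℂ (ξ i) (Matrix.toEuclideanLin A (ξ i)) := by
  have prod_eq_one : ∏ j ∈ Finset.range i,
      inner ℂ (ξ j) (Matrix.toEuclideanLin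
        ((Pi.mulSingle i A : ℕ → Matrix (Fin 2) (Fin 2) ℂ) j) (ξ j)) = 1 := by
    rw [← hφ.apply_siteProd, ← φ.map_one, siteProd_congr (N := 1)
      fun j hj => Pi.mulSingle_eq_of_ne hj.ne _, siteProd_one]
  rw [← siteProd_single, hφ.apply_siteProd, Finset.prod_range_succ, prod_eq_one, one_mul,
    Pi.mulSingle_eq_same]

theorem norm_eq_one (hφ : IsProductOfKets ξ φ) (i : ℕ) : ‖ξ i‖ = 1 := by
  have h := hφ.apply_siteHom i 1
  rw [map_one, φ.map_one, inner_toEuclideanLin_one] at h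
  exact (pow_eq_one_iff_of_nonneg (norm_nonneg _) two_ne_zero).1 (mod_cast h.symm)

theorem tendsto_ofVector (hφ : IsProductOfKets ξ φ) :
    Tendsto (fun n => StateSpace.ofVector qubitLattice (productVector ξ n)
      (norm_productVector hφ.norm_eq_one n)) atTop (𝓝 φ) := by
  refine StateSpace.tendsto_of_dense_span dense_span_siteProdSubmonoid ?_
  rintro _ ⟨n, M, rfl⟩
  refine tendsto_const_nhds.congr' ?_
  filter_upwards [eventually_ge_atTop n] with m hm
  exact (hφ n M).trans (inner_productVector_siteProd_of_le hφ.norm_eq_one hm M).symm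

theorem exists_isProductState (hφ : IsProductOfKets ξ φ) (hψ : IsProductOfKets η ψ) :
    ∃ ω, IsProductState φ ψ ω :=
  exists_isProductState_of_tendsto hφ.tendsto_ofVector hψ.tendsto_ofVector
    fun _ => isProductState_ofVector _ _

theorem norm_inner_eq_one (hξ : IsProductOfKets ξ φ) (hη : IsProductOfKets η φ) (i : ℕ) :
    ‖inner ℂ (ξ i) (η i)‖ = 1 := by
  have h := hη.apply_siteHom i
    (Matrix.toEuclideanLin.symm (InnerProductSpace.rankOne ℂ (ξ i) (ξ i)).toLinearMap)
  rw [hξ.apply_siteHom, LinearEquiv.apply_symm_apply] at h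
  simp only [ContinuousLinearMap.coe_coe, InnerProductSpace.rankOne_apply, inner_smul_right,
    inner_self_eq_one_of_norm_eq_one (𝕜 := ℂ) (hξ.norm_eq_one i), mul_one] at h
  have norm_sq : ‖inner ℂ (ξ i) (η i)‖ ^ 2 = 1 := by
    rw [sq]
    nth_rw 2 [norm_inner_symm]
    rw [← norm_mul, ← h, norm_one]
  exact (pow_eq_one_iff_of_nonneg (norm_nonneg _) two_ne_zero).1 norm_sq

theorem injective {ι : Type*} {v : ℕ → ι → EuclideanSpace ℂ (Fin 2)}
    (hv : ∀ i, Orthonormal ℂ (v i)) {s t : ℕ → ι} (hs : IsProductOfKets (fun i => v i (s i)) φ)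
    (ht : IsProductOfKets (fun i => v i (t i)) φ) : s = t := by
  funext i
  by_contra hne
  have h := hs.norm_inner_eq_one ht i
  rw [(hv i).2 hne, norm_zero] at h
  exact zero_ne_one h

theorem continuous {X : Type*} [TopologicalSpace X] {ξ : X → ℕ → EuclideanSpace ℂ (Fin 2)}
    {φ : X → StateSpace qubitLattice} (hξ : ∀ i, Continuous fun x => ξ x i)
    (hφ : ∀ x, IsProductOfKets (ξ x) (φ x)) : Continuous φ := by
  refine StateSpace.continuous_of_dense_span dense_span_siteProdSubmonoid ?_
  rintro _ ⟨n, M, rfl⟩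
  simp only [fun x => (hφ x).apply_siteProd]
  exact continuous_finsetProd _ fun i _ => (hξ i).inner
    ((LinearMap.continuous_of_finiteDimensional _).comp (hξ i))

end IsProductOfKets

section MatrixTrace

variable {n R N : Type*} [Fintype n] [DecidableEq n] [CommSemiring R] [AddCommMonoid N] [Module R N]
  {f : Matrix n n R →ₗ[R] N}

theorem apply_eq_trace_smul_of_mul_comm (hf : ∀ A B, f (A * B) = f (B * A)) (A : Matrix n n R)
    (k : n) : f A = A.trace • f (Matrix.single k k 1) := by
  have off_diag {i j : n} (hij : i ≠ j) : f (Matrix.single i j 1) = 0 := by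
    simpa [Matrix.single_mul_single_of_ne, hij.symm] using
      hf (Matrix.single i i 1) (Matrix.single i j 1)
  have diag (i : n) : f (Matrix.single i i 1) = f (Matrix.single k k 1) := by
    simpa using hf (Matrix.single i k 1) (Matrix.single k i 1)
  have entry (i j : n) :
      f (Matrix.single i j (A i j)) = if i = j then A i i • f (Matrix.single k k 1) else 0 := by
    rw [← mul_one (A i j), ← smul_eq_mul, ← Matrix.smul_single, map_smul]
    split_ifs with hij
    · rw [← hij, diag]
    · rw [off_diag hij, smul_zero]
  conv_lhs => rw [Matrix.matrix_eq_sum_single A]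
  simp only [map_sum, entry, Finset.sum_ite_eq, Finset.mem_univ, if_true]
  exact (Finset.sum_smul ..).symm

theorem card_nsmul_apply_eq_trace_smul_of_mul_comm (hf : ∀ A B, f (A * B) = f (B * A))
    (A : Matrix n n R) : Fintype.card n • f A = A.trace • f 1 := by
  have hone : ∑ k, f (Matrix.single k k 1) = f 1 := by
    rw [← map_sum, Matrix.sum_single_one]
  rw [← hone, Finset.smul_sum]
  simp only [← apply_eq_trace_smul_of_mul_comm hf, Finset.sum_const, Finset.card_univ]

theorem sum_inner_toEuclideanLin_of_orthonormal {𝕜 ι : Type*} [RCLike 𝕜] [Fintype ι]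
    {v : ι → EuclideanSpace 𝕜 n} (hv : Orthonormal 𝕜 v) (hcard : Fintype.card ι = Fintype.card n)
    (A : Matrix n n 𝕜) : ∑ k, inner 𝕜 (v k) (Matrix.toEuclideanLin A (v k)) = A.trace := by
  have span_eq_top : Submodule.span 𝕜 (Set.range v) = ⊤ :=
    hv.linearIndependent.span_eq_top_of_card_eq_finrank' (by rw [hcard, finrank_euclideanSpace])
  have h := LinearMap.trace_eq_sum_inner (Matrix.toEuclideanLin A)
    (OrthonormalBasis.mk hv span_eq_top.ge)
  rw [OrthonormalBasis.coe_mk] at h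
  rw [← h, Matrix.toEuclideanLin_eq_toLin_orthonormal, Matrix.trace_toLin_eq]

end MatrixTrace

section CoordinateIntegrals

variable {ι 𝕜 : Type*} [RCLike 𝕜] {G : ι → Type*} [∀ i, MeasurableSpace (G i)]
  [∀ i, DiscreteMeasurableSpace (G i)] {μ : Measure (∀ i, G i)}

theorem integrable_mul_coord {F : (∀ i, G i) → 𝕜} (hF : Integrable F μ) (j : ι) [Finite (G j)]
    (g : G j → 𝕜) : Integrable (fun s => F s * g (s j)) μ := by
  obtain ⟨C, hC⟩ := (Set.finite_range fun k => ‖g k‖).bddAbove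
  exact hF.mul_bdd
    ((Measurable.of_discrete (f := g)).comp (measurable_pi_apply j)).aestronglyMeasurable
    (.of_forall fun s => hC ⟨s j, rfl⟩)

theorem integrable_prod_coord [∀ i, Finite (G i)] [IsFiniteMeasure μ] (g : ∀ i, G i → 𝕜)
    (t : Finset ι) : Integrable (fun s => ∏ i ∈ t, g i (s i)) μ := by
  induction t using Finset.cons_induction with
  | empty => simp
  | cons j t hj ih =>
    simpa only [Finset.prod_cons, mul_comm (g j _)] using integrable_mul_coord ih j (g j)

variable [∀ i, AddGroup (G i)] [μ.IsAddLeftInvariant]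

theorem integral_mul_coord [DecidableEq ι] {F : (∀ i, G i) → 𝕜} (hF : Integrable F μ) (j : ι)
    [Fintype (G j)] (hFj : ∀ k s, F (Pi.single j k + s) = F s) (g : G j → 𝕜) :
    ∫ s, F s * g (s j) ∂μ = (∫ s, F s ∂μ) * ((∑ k, g k) / Fintype.card (G j)) := by
  have translate (k : G j) : ∫ s, F s * g (s j) ∂μ = ∫ s, F s * g (k + s j) ∂μ := by
    rw [← integral_add_left_eq_self _ (Pi.single j k)]
    simp only [hFj, Pi.add_apply, Pi.single_eq_same]
  have average : Fintype.card (G j) * ∫ s, F s * g (s j) ∂μ = (∫ s, F s ∂μ) * ∑ k, g k := by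
    calc Fintype.card (G j) * ∫ s, F s * g (s j) ∂μ
        = ∑ k, ∫ s, F s * g (k + s j) ∂μ := by simp [← translate]
      _ = ∫ s, F s * ∑ k, g (k + s j) ∂μ := by
        simp only [Finset.mul_sum]
        exact (integral_finsetSum _ fun k _ => integrable_mul_coord hF j fun x => g (k + x)).symm
      _ = (∫ s, F s ∂μ) * ∑ k, g k := by
        rw [← integral_mul_const]
        exact integral_congr_ae (.of_forall fun s =>
          congrArg (F s * ·) (Fintype.sum_equiv (Equiv.addRight (s j)) _ g fun _ => rfl))
  have card_ne_zero : (Fintype.card (G j) : 𝕜) ≠ 0 := Nat.cast_ne_zero.2 Fintype.card_ne_zero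
  rw [← mul_div_assoc, ← average, mul_div_cancel_left₀ _ card_ne_zero]

theorem integral_prod_coord [∀ i, Fintype (G i)] [IsProbabilityMeasure μ] (g : ∀ i, G i → 𝕜)
    (t : Finset ι) :
    ∫ s, ∏ i ∈ t, g i (s i) ∂μ = ∏ i ∈ t, (∑ k, g i k) / Fintype.card (G i) := by
  classical
  induction t using Finset.cons_induction with
  | empty => simp
  | cons j t hj ih =>
    have hinv (k : G j) (s : ∀ i, G i) :
        ∏ i ∈ t, g i ((Pi.single j k + s) i) = ∏ i ∈ t, g i (s i) :=
      Finset.prod_congr rfl fun i hi => by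
        rw [Pi.add_apply, Pi.single_eq_of_ne (ne_of_mem_of_not_mem hi hj), zero_add]
    simp only [Finset.prod_cons, mul_comm (g j _)]
    rw [integral_mul_coord (integrable_prod_coord g t) j hinv, ih, mul_comm]

end CoordinateIntegrals

namespace StateSpace

variable {σ τ : StateSpace qubitLattice}

theorem IsTracial.apply_siteProd (hσ : σ.IsTracial) (n : ℕ)
    (M : ℕ → Matrix (Fin 2) (Fin 2) ℂ) :
    σ (siteProd n M) = ∏ i ∈ Finset.range n, (M i).trace / 2 := by
  induction n with
  | zero => rw [siteProd_zero, StateSpace.map_one, Finset.range_zero, Finset.prod_empty]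
  | succ n ih =>
    let f : Matrix (Fin 2) (Fin 2) ℂ →ₗ[ℂ] ℂ :=
      (σ : qubitLattice →ₗ[ℂ] ℂ) ∘ₗ LinearMap.mulLeft ℂ (siteProd n M) ∘ₗ
        (siteHom n).toAlgHom.toLinearMap
    have hf (A B : Matrix (Fin 2) (Fin 2) ℂ) : f (A * B) = f (B * A) := by
      change σ (siteProd n M * siteHom n (A * B)) = σ (siteProd n M * siteHom n (B * A))
      rw [map_mul (siteHom n), map_mul (siteHom n), ← mul_assoc, hσ, ← mul_assoc,
        ← (siteProd_commute_siteHom M le_rfl B).eq, mul_assoc]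
    have h : 2 • σ (siteProd n M * siteHom n (M n)) =
        (M n).trace • σ (siteProd n M * siteHom n 1) :=
      card_nsmul_apply_eq_trace_smul_of_mul_comm hf (M n)
    rw [map_one, mul_one, ih, smul_eq_mul, nsmul_eq_mul] at h
    rw [siteProd_succ, Finset.prod_range_succ]
    linear_combination h / 2

theorem IsTracial.unique (hσ : σ.IsTracial) (hτ : τ.IsTracial) : σ = τ := by
  refine ext_of_dense_span dense_span_siteProdSubmonoid ?_
  rintro _ ⟨n, M, rfl⟩
  rw [hσ.apply_siteProd, hτ.apply_siteProd]

theorem isTracial_of_apply_siteProd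
    (h : ∀ n M, σ (siteProd n M) = ∏ i ∈ Finset.range n, (M i).trace / 2) : σ.IsTracial := by
  refine isTracial_of_dense_span dense_span_siteProdSubmonoid ?_
  rintro _ ⟨n, M, rfl⟩ _ ⟨m, N, rfl⟩
  rw [← siteProd_ite_of_le M (le_max_left n m), ← siteProd_ite_of_le N (le_max_right n m),
    ← siteProd_mul, ← siteProd_mul, h, h]
  exact Finset.prod_congr rfl fun i _ => congrArg (· / 2) (Matrix.trace_mul_comm _ _)

end StateSpace

section RandomBasisStates

variable {ket : ℕ → ZMod 2 → EuclideanSpace ℂ (Fin 2)}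
  {latt : (ℕ → ZMod 2) → StateSpace qubitLattice}

theorem continuous_of_isProductOfKets
    (hlatt : ∀ s, IsProductOfKets (fun i => ket i (s i)) (latt s)) :
    Continuous latt :=
  IsProductOfKets.continuous (fun i => continuous_of_discreteTopology.comp (continuous_apply i))
    hlatt

theorem isClosedEmbedding_of_isProductState (hket : ∀ i, Orthonormal ℂ (ket i))
    (hlatt : ∀ s, IsProductOfKets (fun i => ket i (s i)) (latt s))
    {pair : (ℕ → ZMod 2) → StateSpace qubitLatticePair}
    (hpair : ∀ s, IsProductState (latt s) (latt s) (pair s)) : IsClosedEmbedding pair := by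
  have hcont : Continuous latt := continuous_of_isProductOfKets hlatt
  refine (IsProductState.continuous hcont hcont hpair).isClosedEmbedding fun s t hst => ?_
  have latt_eq : latt s = latt t := DFunLike.ext _ _ fun y => by
    rw [← (hpair s).apply_elemTensor_one, ← (hpair t).apply_elemTensor_one, hst]
  exact (hlatt s).injective hket (latt_eq ▸ hlatt t)

variable {μ : Measure (ℕ → ZMod 2)} [μ.IsAddLeftInvariant] [IsProbabilityMeasure μ]
  {σ : StateSpace qubitLattice}

theorem isTracial_of_isBarycenter_map (hket : ∀ i, Orthonormal ℂ (ket i))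
    (hlatt : ∀ s, IsProductOfKets (fun i => ket i (s i)) (latt s))
    (hσ : StateSpace.IsBarycenter (μ.map latt) σ) : σ.IsTracial := by
  refine StateSpace.isTracial_of_apply_siteProd fun n M => ?_
  rw [hσ.apply_eq_integral (continuous_of_isProductOfKets hlatt).aemeasurable]
  simp only [fun s => (hlatt s).apply_siteProd]
  rw [integral_prod_coord
    (fun i k => inner ℂ (ket i k) (Matrix.toEuclideanLin (M i) (ket i k)))]
  exact Finset.prod_congr rfl fun i _ => by
    rw [sum_inner_toEuclideanLin_of_orthonormal (hket i) (ZMod.card 2), ZMod.card, Nat.cast_two]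

theorem exists_isBarycenter_map_isTracial (hket : ∀ i, Orthonormal ℂ (ket i))
    (hlatt : ∀ s, IsProductOfKets (fun i => ket i (s i)) (latt s)) :
    ∃ σ, StateSpace.IsBarycenter (μ.map latt) σ ∧ σ.IsTracial := by
  have : IsProbabilityMeasure (μ.map latt) :=
    Measure.isProbabilityMeasure_map (continuous_of_isProductOfKets hlatt).aemeasurable
  obtain ⟨σ, hσ⟩ := StateSpace.exists_isBarycenter (μ.map latt)
  exact ⟨σ, hσ, isTracial_of_isBarycenter_map hket hlatt hσ⟩

theorem integral_eq_of_isTracial (hket : ∀ i, Orthonormal ℂ (ket i))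
    (hlatt : ∀ s, IsProductOfKets (fun i => ket i (s i)) (latt s)) (hσ : σ.IsTracial)
    (a : qubitLattice) : ∫ s, latt s a ∂μ = σ a := by
  obtain ⟨τ, hτ, hτ_tracial⟩ := exists_isBarycenter_map_isTracial (μ := μ) hket hlatt
  rw [hσ.unique hτ_tracial,
    hτ.apply_eq_integral (continuous_of_isProductOfKets hlatt).aemeasurable]

end RandomBasisStates

theorem exists_isTracial : ∃ τ : StateSpace qubitLattice, τ.IsTracial := by
  let μ : Measure (ℕ → ZMod 2) := Measure.addHaarMeasure ⊤
  have : IsProbabilityMeasure μ := ⟨Measure.addHaarMeasure_self⟩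
  have hket : Orthonormal ℂ fun k : ZMod 2 => EuclideanSpace.basisFun (Fin 2) ℂ k :=
    (EuclideanSpace.basisFun (Fin 2) ℂ).orthonormal
  choose latt hlatt using fun s : ℕ → ZMod 2 => exists_isProductOfKets fun i => hket.1 (s i)
  obtain ⟨τ, -, hτ⟩ := exists_isBarycenter_map_isTracial (μ := μ) (fun _ => hket) hlatt
  exact ⟨τ, hτ⟩

theorem exists_measure_isBarycenter_of_isTracial {ket : ℕ → ZMod 2 → EuclideanSpace ℂ (Fin 2)}
    (hket : ∀ i, Orthonormal ℂ (ket i)) {latt : (ℕ → ZMod 2) → StateSpace qubitLattice}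
    (hlatt : ∀ s, IsProductOfKets (fun i => ket i (s i)) (latt s))
    {pair : (ℕ → ZMod 2) → StateSpace qubitLatticePair}
    (hpair : ∀ s, IsProductState (latt s) (latt s) (pair s))
    {τ : StateSpace qubitLattice} (hτ : τ.IsTracial)
    (μ : Measure (ℕ → ZMod 2)) [μ.IsAddLeftInvariant] [IsProbabilityMeasure μ] :
    ∃ ν : Measure (StateSpace qubitLatticePair), IsProbabilityMeasure ν ∧ ν.Regular ∧
      (∀ S : Set (ℕ → ZMod 2), MeasurableSet S →
        MeasurableSet (pair '' S) ∧ ν (pair '' S) = μ S) ∧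
      ∃ ρ : StateSpace qubitLatticePair, StateSpace.IsBarycenter ν ρ ∧
        ∀ y : qubitLattice, ρ (elemTensor 1 y) = τ y := by
  have hemb := isClosedEmbedding_of_isProductState hket hlatt hpair
  have hmeas : MeasurableEmbedding pair := hemb.measurableEmbedding
  have hprob : IsProbabilityMeasure (μ.map pair) :=
    Measure.isProbabilityMeasure_map hmeas.measurable.aemeasurable
  have hinner : (μ.map pair).InnerRegular := .map_of_continuous hemb.continuous
  obtain ⟨ρ, hρ⟩ := StateSpace.exists_isBarycenter (μ.map pair)
  refine ⟨μ.map pair, hprob, inferInstance,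
    fun S hS => ⟨hmeas.measurableSet_image.2 hS, ?_⟩, ρ, hρ, fun y => ?_⟩
  · rw [hmeas.map_apply, hemb.injective.preimage_image]
  · rw [hρ.apply_eq_integral hmeas.measurable.aemeasurable]
    simp only [fun s => (hpair s).apply_elemTensor_one]
    exact integral_eq_of_isTracial hket hlatt hτ y

theorem mainTheorem6_general {B : Type*} (ket : B → ℕ → ZMod 2 → EuclideanSpace ℂ (Fin 2))
    (hket : ∀ b i, Orthonormal ℂ (ket b i))
    (μ : Measure (ℕ → ZMod 2)) [μ.IsAddLeftInvariant] [IsProbabilityMeasure μ] :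
    ∃ (latt : B → (ℕ → ZMod 2) → StateSpace qubitLattice)
      (pair : B → (ℕ → ZMod 2) → StateSpace qubitLatticePair)
      (τ : StateSpace qubitLattice),
      (∀ b s φ, IsProductOfKets (fun i => ket b i (s i)) φ ↔ φ = latt b s) ∧
      (∀ b s ω, IsProductState (latt b s) (latt b s) ω ↔ ω = pair b s) ∧
      (∀ σ : StateSpace qubitLattice, σ.IsTracial ↔ σ = τ) ∧
      ∀ b : B, ∃ ν : Measure (StateSpace qubitLatticePair),
        IsProbabilityMeasure ν ∧ ν.Regular ∧
        (∀ S : Set (ℕ → ZMod 2), MeasurableSet S →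
          MeasurableSet (pair b '' S) ∧ ν (pair b '' S) = μ S) ∧
        ∃ ρ : StateSpace qubitLatticePair, StateSpace.IsBarycenter ν ρ ∧
          ∀ y : qubitLattice, ρ (elemTensor 1 y) = τ y := by
  choose latt hlatt using fun b (s : ℕ → ZMod 2) =>
    exists_isProductOfKets fun i => (hket b i).1 (s i)
  choose pair hpair using fun b s => (hlatt b s).exists_isProductState (hlatt b s)
  obtain ⟨τ, hτ⟩ := exists_isTracial
  exact ⟨latt, pair, τ,
    fun b s φ => ⟨fun h => h.unique (hlatt b s), fun h => h ▸ hlatt b s⟩,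
    fun b s ω => ⟨fun h => h.unique (hpair b s), fun h => h ▸ hpair b s⟩,
    fun σ => ⟨fun h => h.unique hτ, fun h => h ▸ hτ⟩,
    fun b => exists_measure_isBarycenter_of_isTracial (hket b) (hlatt b) (hpair b) hτ μ⟩

theorem mainTheorem6
    (ket : ZMod 2 → ZMod 2 → EuclideanSpace ℂ (Fin 2))
    (hket : ∀ b, Orthonormal ℂ (ket b))
    (hket_x : ∀ k, ∃ c : ℂ, Matrix.toEuclideanLin pauliX (ket 0 k) = c • ket 0 k)
    (hket_y : ∀ k, ∃ c : ℂ, Matrix.toEuclideanLin pauliY (ket 1 k) = c • ket 1 k)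
    (μ : Measure (ℕ → ZMod 2)) [μ.IsAddHaarMeasure] [IsProbabilityMeasure μ] :
    ∃ (latt : ZMod 2 → (ℕ → ZMod 2) → StateSpace qubitLattice)
      (pair : ZMod 2 → (ℕ → ZMod 2) → StateSpace qubitLatticePair)
      (τ : StateSpace qubitLattice),
      -- `latt b s` is the unique state `⨂ᵢ |b, s(i)⟩` of the lattice algebra
      (∀ b s φ, IsProductOfKets (fun i => ket b (s i)) φ ↔ φ = latt b s) ∧
      -- `pair b s` is the unique product state `|b, s⟩_A ⊗ |b, s⟩_B`
      (∀ b s ω, IsProductState (latt b s) (latt b s) ω ↔ ω = pair b s) ∧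
      -- `τ` is the unique tracial state
      (∀ σ : StateSpace qubitLattice, σ.IsTracial ↔ σ = τ) ∧
      ∀ b : ZMod 2, ∃ ν : Measure (StateSpace qubitLatticePair),
        IsProbabilityMeasure ν ∧ ν.Regular ∧
        (∀ S : Set (ℕ → ZMod 2), MeasurableSet S →
          MeasurableSet (pair b '' S) ∧ ν (pair b '' S) = μ S) ∧
        ∃ ρ : StateSpace qubitLatticePair, StateSpace.IsBarycenter ν ρ ∧
          ∀ y : qubitLattice, ρ (elemTensor 1 y) = τ y :=
  mainTheorem6_general (fun b _ => ket b) (fun b _ => hket b) μ
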